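/- By a representation of a topological group we mean a quasi-complete, locally convex, Hausdorff topological vector space over $\mathbb{C}$ together with a continuous linear action of the group on it. Let $G$ be either a real reductive group (a Lie group with finitely many connected components and reductive Lie algebra $\mathfrak g$, whose connected Lie subgroup with Lie algebra $[\mathfrak g,\mathfrak g]$ has finite center) or a second-countable totally disconnected locally compact Hausdorff topological group. In the real reductive case, "admissible smooth representation" means Casselman–Wallach representation, and $\pi^\vee$ denotes the Casselman–Wallach contragredient of $\pi$; in the totally disconnected case the term has its usual meaning, $\pi^\vee$ is the space of smooth vectors in the linear dual of $\pi$, and $\pi$ and $\pi^\vee$ carry the finest locally convex topology. A topological automorphism $\sigma': G\to G$ is called a Chevalley automorphism if for every irreducible admissible smooth representation $\pi$ of $G$ there is a topological linear isomorphism $A:\pi\to\pi^\vee$ with $A(g.u)=\sigma'(g).A(u)$ for all $g\in G$, $u\in\pi$. Let $H_1, H_2$ be topological groups, regarded as subgroups of $G$ through fixed injective continuous homomorphisms $H_1\to G$ and $H_2\to G$, and let $\omega_1$, $\omega_2$ be representations of $H_1$, $H_2$, respectively. For a representation $\pi$ of $G$ and $i\in\{1,2\}$, let $\mathrm B_{H_i}(\pi\times\omega_i,\mathbb{C})$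 be the complex vector space of all $H_i$-invariant separately continuous bilinear forms $\pi\times\omega_i\to\mathbb{C}$. Suppose that there exist a Chevalley automorphism $\sigma': G\to G$ and a topological linear isomorphism $\varphi:\omega_1\to\omega_2$ such that $\sigma'(H_1)=H_2$ and $\varphi(h.u)=\sigma'(h).\varphi(u)$ for all $h\in H_1$, $u\in\omega_1$. Then, for every irreducible admissible smooth representation $\pi$ of $G$, \[ \dim \mathrm B_{H_1}(\pi\times\omega_1,\mathbb{C})=\dim \mathrm B_{H_2}(\pi^\vee\times\omega_2,\mathbb{C}), \] as an equality of (possibly infinite) cardinal numbers. -/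

import Mathlib

open Filter Topology MeasureTheory
open scoped Manifold ContDiff

noncomputable section

namespace Periods

/-! ### Topological vector spaces -/

section TVS

variable (V : Type*) [AddCommGroup V] [Module ℂ V] [TopologicalSpace V]

/-- `V`, with its given topology, is a locally convex topological vector space over `ℂ`. -/
structure IsLocallyConvexTVS : Prop where
  isTopologicalAddGroup : IsTopologicalAddGroup V
  continuousSMul : ContinuousSMul ℂ V
  locallyConvexSpace : LocallyConvexSpace ℝ V

/-- `V` is a quasi-complete, locally convex, Hausdorff topological vector space over `ℂ`. -/
structure IsQuasiCompleteLCS : Prop extends IsLocallyConvexTVS V where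
  t2Space : T2Space V
  quasiComplete :
    letI : UniformSpace V := IsTopologicalAddGroup.rightUniformSpace V
    QuasiCompleteSpace ℂ V

/-- `V` is a Fréchet space over `ℂ`: a locally convex, Hausdorff, first countable
(hence metrizable) and complete topological vector space. -/
structure IsFrechet : Prop extends IsLocallyConvexTVS V where
  t2Space : T2Space V
  firstCountable : FirstCountableTopology V
  complete :
    letI : UniformSpace V := IsTopologicalAddGroup.rightUniformSpace V
    CompleteSpace V

end TVS

/-- The finest locally convex vector space topology on a complex vector space: the infimum, in
Mathlib's order in which smaller means finer, of all such topologies. -/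
@[reducible] def finestLocallyConvex (V : Type*) [AddCommGroup V] [Module ℂ V] : TopologicalSpace V :=
  sInf {t | @IsLocallyConvexTVS V _ _ t}

/-! ### Representations of topological groups and periods -/

section Rep

variable {G : Type*} [Group G] [TopologicalSpace G]
  {V : Type*} [AddCommGroup V] [Module ℂ V] [TopologicalSpace V]

/-- A linear action `π` of the topological group `G` on `V` is a representation if `V` is a
quasi-complete, locally convex, Hausdorff space and the action map `G × V → V` is continuous. -/
structure IsTopRep (π : Representation ℂ G V) : Prop where
  space : IsQuasiCompleteLCS V
  continuous_action : Continuous fun p : G × V => π p.1 p.2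

/-- The closed `G`-stable subspaces of `V`. -/
def ClosedSubrep (π : Representation ℂ G V) : Type _ :=
  {W : Submodule ℂ V // IsClosed (W : Set V) ∧ ∀ g, ∀ v ∈ W, π g v ∈ W}

instance (π : Representation ℂ G V) : PartialOrder (ClosedSubrep π) :=
  inferInstanceAs (PartialOrder {W : Submodule ℂ V //
    IsClosed (W : Set V) ∧ ∀ g, ∀ v ∈ W, π g v ∈ W})

/-- (Topological) irreducibility: `V` is nonzero and `0` and `V` are its only closed `G`-stable
subspaces. If `V` carries the finest locally convex topology, then all subspaces are closed, and
this is algebraic irreducibility. -/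
def IsIrreducibleRep (π : Representation ℂ G V) : Prop :=
  Nontrivial V ∧ ∀ W : ClosedSubrep π, W.1 = ⊥ ∨ W.1 = ⊤

end Rep

/-- The space `B_H(π × τ, ℂ)` of `H`-invariant separately continuous bilinear forms on `π × τ`,
where `H` acts on `π` through the homomorphism `ι : H → G`. -/
def periods {G H : Type*} [Group G] [Group H] (ι : H →* G)
    {V W : Type*} [AddCommGroup V] [Module ℂ V] [TopologicalSpace V]
    [AddCommGroup W] [Module ℂ W] [TopologicalSpace W]
    (π : Representation ℂ G V) (τ : Representation ℂ H W) :
    Submodule ℂ (V →ₗ[ℂ] W →ₗ[ℂ] ℂ) where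
  carrier := {b | (∀ v, Continuous fun w => b v w) ∧ (∀ w, Continuous fun v => b v w) ∧
    ∀ h v w, b (π (ι h) v) (τ h w) = b v w}
  zero_mem' := by
    refine ⟨fun _ => ?_, fun _ => ?_, fun _ _ _ => rfl⟩ <;> exact continuous_const
  add_mem' := by
    rintro a b ⟨ha, ha', ha''⟩ ⟨hb, hb', hb''⟩
    refine ⟨fun v => (ha v).add (hb v), fun w => (ha' w).add (hb' w), fun h v w => ?_⟩
    simp [ha'', hb'']
  smul_mem' := by
    rintro c b ⟨hb, hb', hb''⟩
    refine ⟨fun v => (hb v).const_smul c, fun w => (hb' w).const_smul c, fun h v w => ?_⟩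
    simp [hb'']

/-! ### Totally disconnected groups -/

namespace TotDisc

variable {G : Type*} [Group G] [TopologicalSpace G]

section

variable {V : Type*} [AddCommGroup V] [Module ℂ V]

/-- Every vector is fixed by an open subgroup. -/
def IsSmooth (π : Representation ℂ G V) : Prop :=
  ∀ v, ∃ U : Subgroup G, IsOpen (U : Set G) ∧ ∀ g ∈ U, π g v = v

/-- The subspace of vectors fixed by the subgroup `U`. -/
def fixedBy (π : Representation ℂ G V) (U : Subgroup G) : Submodule ℂ V where
  carrier := {v | ∀ g ∈ U, π g v = v}
  zero_mem' := by simp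
  add_mem' := by
    intro a b ha hb g hg
    simp [ha g hg, hb g hg]
  smul_mem' := by
    intro c a ha g hg
    simp [ha g hg]

/-- For every compact open subgroup `U`, the space of `U`-fixed vectors is finite-dimensional. -/
def IsAdmissible (π : Representation ℂ G V) : Prop :=
  ∀ U : Subgroup G, IsOpen (U : Set G) → IsCompact (U : Set G) →
    Module.Finite ℂ (fixedBy π U)

/-- The smooth vectors in the full linear dual. -/
def smoothDual [IsTopologicalGroup G] (π : Representation ℂ G V) :
    Subrepresentation π.dual where
  toSubmodule :=
    { carrier := {l | ∃ U : Subgroup G, IsOpen (U : Set G) ∧ ∀ g ∈ U, π.dual g l = l}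
      zero_mem' := ⟨⊤, isOpen_univ, fun g _ => map_zero _⟩
      add_mem' := by
        rintro a b ⟨U, hU, ha⟩ ⟨U', hU', hb⟩
        refine ⟨U ⊓ U', hU.inter hU', fun g hg => ?_⟩
        rw [map_add, ha g hg.1, hb g hg.2]
      smul_mem' := by
        rintro c a ⟨U, hU, ha⟩
        refine ⟨U, hU, fun g hg => ?_⟩
        rw [map_smul, ha g hg] }
  apply_mem_toSubmodule := by
    rintro g l ⟨U, hU, hl⟩
    refine ⟨U.comap (MulAut.conj g⁻¹).toMonoidHom, ?_, fun x hx => ?_⟩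
    · exact hU.preimage (f := fun x : G => g⁻¹ * x * g⁻¹⁻¹) (by fun_prop)
    · have h1 : π.dual (g⁻¹ * x * g⁻¹⁻¹) l = l := hl _ hx
      have h2 : x * g = g * (g⁻¹ * x * g⁻¹⁻¹) := by group
      rw [← Module.End.mul_apply, ← map_mul, h2, map_mul, Module.End.mul_apply, h1]

/-- The underlying space of the contragredient representation. -/
def Contragredient [IsTopologicalGroup G] (π : Representation ℂ G V) : Type _ :=
  (smoothDual π).toSubmodule

variable [IsTopologicalGroup G] (π : Representation ℂ G V)

instance : AddCommGroup (Contragredient π) :=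
  inferInstanceAs (AddCommGroup (smoothDual π).toSubmodule)

instance : Module ℂ (Contragredient π) :=
  inferInstanceAs (Module ℂ (smoothDual π).toSubmodule)

instance : TopologicalSpace (Contragredient π) := finestLocallyConvex (Contragredient π)

/-- The contragredient of `π`: the smooth vectors in the dual, with the finest locally convex
topology. -/
def contragredient : Representation ℂ G (Contragredient π) :=
  (smoothDual π).toRepresentation

end

/-- Irreducible admissible smooth representations of a totally disconnected group, with the finest
locally convex topology on the space. -/
structure IsIrrAdmissibleSmooth {V : Type*} [AddCommGroup V] [Module ℂ V] [t : TopologicalSpace V]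
    (π : Representation ℂ G V) : Prop where
  isTopRep : IsTopRep π
  topology_eq : t = finestLocallyConvex V
  smooth : IsSmooth π
  admissible : IsAdmissible π
  irreducible : IsIrreducibleRep π

/-- Every irreducible admissible smooth `π` is isomorphic to its contragredient by a topological
linear isomorphism that is equivariant with respect to `σ`. -/
def IsChevalley.{v, g} {G : Type g} [Group G] [TopologicalSpace G] [IsTopologicalGroup G]
    (σ : G ≃ₜ* G) : Prop :=
  ∀ (V : Type v) [AddCommGroup V] [Module ℂ V] [TopologicalSpace V] (π : Representation ℂ G V),
    IsIrrAdmissibleSmooth π → ∃ A : V ≃L[ℂ] Contragredient π,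
      ∀ g v, A (π g v) = contragredient π (σ g) (A v)

end TotDisc

/-! ### Real reductive groups -/

namespace Arch

variable {E : Type*} [NormedAddCommGroup E] [NormedSpace ℝ E]

section Group

variable (E) (G : Type*) [TopologicalSpace G] [ChartedSpace E G] [Group G]

/-- The subgroup of `G` generated by the elements `γ 1`, where `γ` is a smooth one-parameter
subgroup of `G` whose initial velocity lies in the set `S` of tangent vectors at the identity.
As `γ 1` is the exponential of that velocity, this is the connected Lie subgroup with Lie algebra
`S` if `S` is a Lie subalgebra. -/
def connectedLieSubgroup (S : Set (GroupLieAlgebra 𝓘(ℝ, E) G)) : Subgroup G :=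
  Subgroup.closure {x | ∃ γ : ℝ → G, ContMDiff 𝓘(ℝ, ℝ) 𝓘(ℝ, E) ∞ γ ∧
    (∀ s t, γ (s + t) = γ s * γ t) ∧
    (∃ X ∈ S, (mfderiv 𝓘(ℝ, ℝ) 𝓘(ℝ, E) γ 0 (1 : ℝ) : E) = X) ∧ γ 1 = x}

instance [LieGroup 𝓘(ℝ, E) ∞ G] : LieGroup 𝓘(ℝ, E) (minSmoothness ℝ 3) G :=
  LieGroup.of_le (m := minSmoothness ℝ 3) (n := ∞) <| by
    rw [minSmoothness_of_isRCLikeNormedField]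
    exact WithTop.coe_le_coe.2 le_top

/-- A Lie group is real reductive if its Lie algebra `𝔤` is reductive (the radical is the center),
it has finitely many connected components, and the connected Lie subgroup with Lie algebra `[𝔤, 𝔤]`
has a finite center. -/
structure IsRealReductive [FiniteDimensional ℝ E] [LieGroup 𝓘(ℝ, E) ∞ G] : Prop where
  reductive :
    letI : CompleteSpace E := FiniteDimensional.complete ℝ E
    LieAlgebra.radical ℝ (GroupLieAlgebra 𝓘(ℝ, E) G) =
      LieAlgebra.center ℝ (GroupLieAlgebra 𝓘(ℝ, E) G)
  finite_components : Finite (ConnectedComponents G)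
  finite_center :
    letI : CompleteSpace E := FiniteDimensional.complete ℝ E
    Finite (Subgroup.center (connectedLieSubgroup E G
      (LieAlgebra.derivedSeries ℝ (GroupLieAlgebra 𝓘(ℝ, E) G) 1 :
        Set (GroupLieAlgebra 𝓘(ℝ, E) G))))

end Group

/-- `f : E → V` is of class `C^n` on the open set `U`, for a topological vector space `V`: the
iterated directional derivatives of order at most `n` exist and are continuous on `U`. -/
def ContDirDiffOn {V : Type*} [AddCommGroup V] [Module ℂ V] [TopologicalSpace V] :
    ℕ → Set E → (E → V) → Prop
  | 0, U, f => ContinuousOn f U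
  | n + 1, U, f => ContinuousOn f U ∧ ∀ e : E, ∃ f' : E → V, ContDirDiffOn n U f' ∧
      ∀ x ∈ U, Tendsto (fun t : ℝ => ((t⁻¹ : ℝ) : ℂ) • (f (x + t • e) - f x)) (𝓝[≠] 0) (𝓝 (f' x))

section Rep

variable {G : Type*} [TopologicalSpace G] [Group G]
  {V : Type*} [AddCommGroup V] [Module ℂ V] [TopologicalSpace V]

/-- All orbit maps `g ↦ π g v` are smooth maps from `G` to `V`, as read in the charts of `G`. -/
def IsSmooth (E : Type*) [NormedAddCommGroup E] [NormedSpace ℝ E] [ChartedSpace E G]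
    (π : Representation ℂ G V) : Prop :=
  ∀ (v : V) (x : G) (n : ℕ), ContDirDiffOn n (chartAt E x).target
    fun y => π ((chartAt E x).symm y) v

/-- Moderate growth: for every continuous seminorm `p` there are a continuous seminorm `q` and a
scale `s`, that is, a positive, locally bounded, submultiplicative function on `G`, such that
`p (g v) ≤ s(g) q(v)`. -/
def IsModerateGrowth (π : Representation ℂ G V) : Prop :=
  ∀ p : Seminorm ℂ V, Continuous p → ∃ (q : Seminorm ℂ V) (s : G → ℝ), Continuous q ∧
    (∀ g, 0 < s g) ∧ (∀ g h, s (g * h) ≤ s g * s h) ∧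
    (∀ g, ∃ U ∈ 𝓝 g, BddAbove (s '' U)) ∧ ∀ g v, p (π g v) ≤ s g * q v

/-- Every irreducible continuous finite-dimensional representation of a maximal compact subgroup
`K` has finite multiplicity in `π`. (Maximal compact subgroups are conjugate to each other.) -/
def IsAdmissible (π : Representation ℂ G V) : Prop :=
  ∃ K : Subgroup G, Maximal (fun K : Subgroup G => IsCompact (K : Set G)) K ∧
    ∀ (n : ℕ) (τ : Representation ℂ K (Fin n → ℂ)),
      Continuous (fun p : K × (Fin n → ℂ) => τ p.1 p.2) → τ.IsIrreducible →
        Module.Finite ℂ (Representation.IntertwiningMap τ (MonoidHom.comp π K.subtype))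

/-- Casselman–Wallach representations: smooth Fréchet representations of moderate growth that are
admissible and of finite length. -/
structure IsCasselmanWallach (E : Type*) [NormedAddCommGroup E] [NormedSpace ℝ E]
    [ChartedSpace E G] (π : Representation ℂ G V) : Prop where
  isTopRep : IsTopRep π
  frechet : IsFrechet V
  smooth : IsSmooth E π
  moderateGrowth : IsModerateGrowth π
  admissible : IsAdmissible π
  finiteLength : ∃ n : ℕ, ∀ s : LTSeries (ClosedSubrep π), s.length ≤ n

/-- The functionals `f.l`, where `f` is a smooth function on `G` with compact support, `l` is a
continuous linear functional on `V`, and `(f.l)(v) = ∫ f(g) l(g⁻¹ v) dg` for a Haar measure. -/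
def gardingSet (E : Type*) [NormedAddCommGroup E] [NormedSpace ℝ E] [ChartedSpace E G]
    (π : Representation ℂ G V) : Set (Module.Dual ℂ V) :=
  letI : MeasurableSpace G := borel G
  {m | ∃ (f : G → ℂ) (l : Module.Dual ℂ V) (μ : Measure G),
    ContMDiff 𝓘(ℝ, E) 𝓘(ℝ, ℂ) ∞ f ∧ HasCompactSupport f ∧ Continuous l ∧ μ.IsHaarMeasure ∧
    ∀ v, m v = ∫ g, f g * l (π g⁻¹ v) ∂μ}

theorem dual_mem_gardingSet (E : Type*) [NormedAddCommGroup E] [NormedSpace ℝ E]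
    [ChartedSpace E G] [LieGroup 𝓘(ℝ, E) ∞ G] (π : Representation ℂ G V) (g : G)
    {m : Module.Dual ℂ V} (hm : m ∈ gardingSet E π) : π.dual g m ∈ gardingSet E π := by
  let _ : MeasurableSpace G := borel G
  have _ : BorelSpace G := ⟨rfl⟩
  have _ : IsTopologicalGroup G := topologicalGroup_of_lieGroup 𝓘(ℝ, E) ∞
  obtain ⟨f, l, μ, hf, hfc, hl, hμ, hm⟩ := hm
  refine ⟨fun x => f (g⁻¹ * x), l, μ, hf.comp contMDiff_mul_left,
    hfc.comp_homeomorph (Homeomorph.mulLeft g⁻¹), hl, hμ, fun v => ?_⟩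
  have h : ∀ x, f x * l (π x⁻¹ (π g⁻¹ v)) =
      (fun y => f (g⁻¹ * y) * l (π y⁻¹ v)) (g * x) := by
    intro x
    simp only [inv_mul_cancel_left, mul_inv_rev, map_mul, Module.End.mul_apply]
  change m (π g⁻¹ v) = _
  rw [hm, ← integral_mul_left_eq_self (fun y => f (g⁻¹ * y) * l (π y⁻¹ v)) g]
  exact integral_congr_ae (Eventually.of_forall h)

/-- The span of the functionals `f.l`. For a Casselman–Wallach representation `π`, these are the
functionals in the Casselman–Wallach representation that has the `K`-finite dual of `π` as its
Harish-Chandra module, realized in the continuous dual of `π`. -/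
def smoothDual (E : Type*) [NormedAddCommGroup E] [NormedSpace ℝ E] [ChartedSpace E G]
    [LieGroup 𝓘(ℝ, E) ∞ G] (π : Representation ℂ G V) : Subrepresentation π.dual where
  toSubmodule := Submodule.span ℂ (gardingSet E π)
  apply_mem_toSubmodule := by
    intro g m hm
    induction hm using Submodule.span_induction with
    | mem x hx => exact Submodule.subset_span (dual_mem_gardingSet E π g hx)
    | zero => rw [map_zero]; exact zero_mem _
    | add x y _ _ hx hy => rw [map_add]; exact add_mem hx hy
    | smul c x _ hx => rw [map_smul]; exact Submodule.smul_mem _ c hx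

/-- The underlying space of the contragredient representation. -/
def Contragredient (E : Type*) [NormedAddCommGroup E] [NormedSpace ℝ E] [ChartedSpace E G]
    [LieGroup 𝓘(ℝ, E) ∞ G] (π : Representation ℂ G V) : Type _ :=
  (smoothDual E π).toSubmodule

section

variable (E : Type*) [NormedAddCommGroup E] [NormedSpace ℝ E] [ChartedSpace E G]
  [LieGroup 𝓘(ℝ, E) ∞ G] (π : Representation ℂ G V)

instance : AddCommGroup (Contragredient E π) :=
  inferInstanceAs (AddCommGroup (smoothDual E π).toSubmodule)

instance : Module ℂ (Contragredient E π) :=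
  inferInstanceAs (Module ℂ (smoothDual E π).toSubmodule)

/-- The Fréchet topology of the contragredient: the topology that makes it a Fréchet space on which
all evaluations at vectors of `π` are continuous. By the closed graph theorem there is at most one
such topology, so that the infimum picks it out. -/
instance : TopologicalSpace (Contragredient E π) :=
  sInf {t | @IsFrechet (Contragredient E π) _ _ t ∧
    ∀ v : V, @Continuous _ _ t _ fun l : Contragredient E π => (l.1 : Module.Dual ℂ V) v}

/-- The contragredient `π^∨` of a Casselman–Wallach representation `π`. -/
def contragredient : Representation ℂ G (Contragredient E π) :=
  (smoothDual E π).toRepresentation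

end

/-- Irreducible Casselman–Wallach representations. These are the irreducible admissible smooth
representations of a real reductive group. -/
structure IsIrrAdmissibleSmooth (E : Type*) [NormedAddCommGroup E] [NormedSpace ℝ E]
    [ChartedSpace E G] (π : Representation ℂ G V) : Prop where
  casselmanWallach : IsCasselmanWallach E π
  irreducible : IsIrreducibleRep π

end Rep

/-- Every irreducible admissible smooth `π` is isomorphic to its contragredient by a topological
linear isomorphism that is equivariant with respect to `σ`. -/
def IsChevalley.{v, e, g} (E : Type e) [NormedAddCommGroup E] [NormedSpace ℝ E]
    {G : Type g} [TopologicalSpace G] [ChartedSpace E G] [Group G] [LieGroup 𝓘(ℝ, E) ∞ G]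
    (σ : G ≃ₜ* G) : Prop :=
  ∀ (V : Type v) [AddCommGroup V] [Module ℂ V] [TopologicalSpace V] (π : Representation ℂ G V),
    IsIrrAdmissibleSmooth E π → ∃ A : V ≃L[ℂ] Contragredient E π,
      ∀ g v, A (π g v) = contragredient E π (σ g) (A v)

end Arch

end Periods

end

universe uE uG uH₁ uH₂ uW₁ uW₂ uV

namespace Periods

open Cardinal

section Transport

variable {G H₁ H₂ V V' W₁ W₂ : Type*} [Group G] [Group H₁] [Group H₂]
  [AddCommGroup V] [Module ℂ V] [TopologicalSpace V]
  [AddCommGroup V'] [Module ℂ V'] [TopologicalSpace V']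
  [AddCommGroup W₁] [Module ℂ W₁] [TopologicalSpace W₁]
  [AddCommGroup W₂] [Module ℂ W₂] [TopologicalSpace W₂]
  {ι₁ : H₁ →* G} {ι₂ : H₂ →* G} {σ : G → G}
  {π : Representation ℂ G V} {π' : Representation ℂ G V'}
  {ω₁ : Representation ℂ H₁ W₁} {ω₂ : Representation ℂ H₂ W₂}

/-! The whole argument is transport of structure. A Chevalley automorphism `σ` supplies for each `π`
a topological isomorphism `A` onto the contragredient that intertwines the action of `g` with that
of `σ g`. Then `b ↦ b (A ·) (φ ·)` is a linear bijection from bilinear forms on `π^∨ × ω₂` to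
bilinear forms on `π × ω₁`. It respects separate continuity because `A` and `φ` are homeomorphisms,
and it turns `H₂`-invariance into `H₁`-invariance because `σ` carries `H₁` onto `H₂`. Nothing about
the construction of the contragredient enters beyond the existence of `A`, so `periodsEquiv` and
`lift_rank_periods_eq` are stated for an arbitrary target `π'` and serve both classes of groups. The
hypothesis `hφ` treats `σ : H₁ → H₂` as a relation between `h₁` and `h₂`, which avoids inverting
`ι₂` on its range. -/

/-- Isomorphisms `A : π → π'` and `φ : ω₁ → ω₂` that are equivariant with respect to a map `σ`
taking `H₁` onto `H₂` identify the periods of `π × ω₁` with those of `π' × ω₂`. -/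
noncomputable def periodsEquiv (A : V ≃L[ℂ] V') (φ : W₁ ≃L[ℂ] W₂)
    (hσ : σ '' Set.range ι₁ = Set.range ι₂)
    (hA : ∀ g v, A (π g v) = π' (σ g) (A v))
    (hφ : ∀ h₁ h₂, ι₂ h₂ = σ (ι₁ h₁) → ∀ u, φ (ω₁ h₁ u) = ω₂ h₂ (φ u)) :
    periods ι₁ π ω₁ ≃ₗ[ℂ] periods ι₂ π' ω₂ :=
  -- The `symm` of `arrowCongr` is the pullback `b ↦ b (A ·) (φ ·)`. What remains is that the
  -- preimage of the `H₁`-periods under it is exactly the space of `H₂`-periods.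
  (LinearEquiv.ofSubmodule'
      (A.toLinearEquiv.arrowCongr (φ.toLinearEquiv.arrowCongr (LinearEquiv.refl ℂ ℂ))).symm
      (periods ι₁ π ω₁)).symm ≪≫ₗ LinearEquiv.ofEq _ _ (by
    ext b
    constructor
    · rintro ⟨h₁, h₂, h₃⟩
      refine ⟨fun v => ?_, fun w => ?_, fun h v w => ?_⟩
      · simpa [Function.comp_def] using (h₁ (A.symm v)).comp φ.symm.continuous
      · simpa [Function.comp_def] using (h₂ (φ.symm w)).comp A.symm.continuous
      -- Here `H₂ ⊆ σ(H₁)` is needed: invariance under `h` is invariance of the pullback under some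
      -- `k` with `σ (ι₁ k) = ι₂ h`.
      · obtain ⟨_, ⟨k, rfl⟩, hk⟩ := hσ.ge ⟨h, rfl⟩
        have := h₃ k (A.symm v) (φ.symm w)
        simpa [hA, hφ k h hk.symm, hk] using this
    · rintro ⟨h₁, h₂, h₃⟩
      refine ⟨fun v => ?_, fun w => ?_, fun k v w => ?_⟩
      · simpa [Function.comp_def] using (h₁ (A v)).comp φ.continuous
      · simpa [Function.comp_def] using (h₂ (φ w)).comp A.continuous
      -- The converse needs the other inclusion, `σ(H₁) ⊆ H₂`.
      · obtain ⟨h, hh⟩ := hσ.le ⟨_, ⟨k, rfl⟩, rfl⟩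
        simpa [hA, hφ k h hh, ← hh] using h₃ h (A v) (φ w))

end Transport

universe v w₁ w₂

/-- `W₁` and `W₂` may lie in different universes, so the two dimensions are compared as cardinals
after lifting. `V` and `V'` share a universe, as a representation and its contragredient do. -/
theorem lift_rank_periods_eq {G H₁ H₂ : Type*} [Group G] [Group H₁] [Group H₂]
    {V V' : Type v} {W₁ : Type w₁} {W₂ : Type w₂}
    [AddCommGroup V] [Module ℂ V] [TopologicalSpace V]
    [AddCommGroup V'] [Module ℂ V'] [TopologicalSpace V']
    [AddCommGroup W₁] [Module ℂ W₁] [TopologicalSpace W₁]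
    [AddCommGroup W₂] [Module ℂ W₂] [TopologicalSpace W₂]
    {ι₁ : H₁ →* G} {ι₂ : H₂ →* G} {σ : G → G}
    {π : Representation ℂ G V} {π' : Representation ℂ G V'}
    {ω₁ : Representation ℂ H₁ W₁} {ω₂ : Representation ℂ H₂ W₂}
    (A : V ≃L[ℂ] V') (φ : W₁ ≃L[ℂ] W₂)
    (hσ : σ '' Set.range ι₁ = Set.range ι₂)
    (hA : ∀ g v, A (π g v) = π' (σ g) (A v))
    (hφ : ∀ h₁ h₂, ι₂ h₂ = σ (ι₁ h₁) → ∀ u, φ (ω₁ h₁ u) = ω₂ h₂ (φ u)) :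
    lift.{w₂} (Module.rank ℂ (periods ι₁ π ω₁)) =
      lift.{w₁} (Module.rank ℂ (periods ι₂ π' ω₂)) := by
  -- Lifting the spaces themselves puts both in the universe `max v w₁ w₂`, where
  -- `LinearEquiv.rank_eq` applies.
  let e : ULift.{w₂} (periods ι₁ π ω₁) ≃ₗ[ℂ] ULift.{w₁} (periods ι₂ π' ω₂) :=
    ULift.moduleEquiv ≪≫ₗ periodsEquiv A φ hσ hA hφ ≪≫ₗ ULift.moduleEquiv.symm
  have h₁ : Module.rank ℂ (ULift.{w₂} (periods ι₁ π ω₁)) = _ := rank_ulift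
  have h₂ : Module.rank ℂ (ULift.{w₁} (periods ι₂ π' ω₂)) = _ := rank_ulift
  exact h₁.symm.trans (e.rank_eq.trans h₂)

end Periods

theorem mainTheorem6 :
    (∀ (E : Type uE) [NormedAddCommGroup E] [NormedSpace ℝ E] [FiniteDimensional ℝ E]
      (G : Type uG) [TopologicalSpace G] [ChartedSpace E G] [Group G] [LieGroup 𝓘(ℝ, E) ∞ G],
      Periods.Arch.IsRealReductive E G →
      ∀ (H₁ : Type uH₁) [TopologicalSpace H₁] [Group H₁] [IsTopologicalGroup H₁]
        (H₂ : Type uH₂) [TopologicalSpace H₂] [Group H₂] [IsTopologicalGroup H₂]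
        (ι₁ : H₁ →ₜ* G) (ι₂ : H₂ →ₜ* G),
        Function.Injective ι₁ → Function.Injective ι₂ →
      ∀ (W₁ : Type uW₁) [AddCommGroup W₁] [Module ℂ W₁] [TopologicalSpace W₁]
        (W₂ : Type uW₂) [AddCommGroup W₂] [Module ℂ W₂] [TopologicalSpace W₂]
        (ω₁ : Representation ℂ H₁ W₁) (ω₂ : Representation ℂ H₂ W₂),
        Periods.IsTopRep ω₁ → Periods.IsTopRep ω₂ →
      ∀ (σ : G ≃ₜ* G) (φ : W₁ ≃L[ℂ] W₂),
        Periods.Arch.IsChevalley.{uV, uE, uG} E σ →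
        σ '' Set.range ι₁ = Set.range ι₂ →
        (∀ h₁ h₂, ι₂ h₂ = σ (ι₁ h₁) → ∀ u, φ (ω₁ h₁ u) = ω₂ h₂ (φ u)) →
      ∀ (V : Type uV) [AddCommGroup V] [Module ℂ V] [TopologicalSpace V]
        (π : Representation ℂ G V), Periods.Arch.IsIrrAdmissibleSmooth E π →
        Cardinal.lift.{uW₂} (Module.rank ℂ (Periods.periods (ι₁ : H₁ →* G) π ω₁)) =
          Cardinal.lift.{uW₁} (Module.rank ℂ (Periods.periods (ι₂ : H₂ →* G)
            (Periods.Arch.contragredient E π) ω₂))) ∧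
    (∀ (G : Type uG) [TopologicalSpace G] [Group G] [IsTopologicalGroup G] [T2Space G]
      [LocallyCompactSpace G] [TotallyDisconnectedSpace G] [SecondCountableTopology G],
      ∀ (H₁ : Type uH₁) [TopologicalSpace H₁] [Group H₁] [IsTopologicalGroup H₁]
        (H₂ : Type uH₂) [TopologicalSpace H₂] [Group H₂] [IsTopologicalGroup H₂]
        (ι₁ : H₁ →ₜ* G) (ι₂ : H₂ →ₜ* G),
        Function.Injective ι₁ → Function.Injective ι₂ →
      ∀ (W₁ : Type uW₁) [AddCommGroup W₁] [Module ℂ W₁] [TopologicalSpace W₁]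
        (W₂ : Type uW₂) [AddCommGroup W₂] [Module ℂ W₂] [TopologicalSpace W₂]
        (ω₁ : Representation ℂ H₁ W₁) (ω₂ : Representation ℂ H₂ W₂),
        Periods.IsTopRep ω₁ → Periods.IsTopRep ω₂ →
      ∀ (σ : G ≃ₜ* G) (φ : W₁ ≃L[ℂ] W₂),
        Periods.TotDisc.IsChevalley.{uV, uG} σ →
        σ '' Set.range ι₁ = Set.range ι₂ →
        (∀ h₁ h₂, ι₂ h₂ = σ (ι₁ h₁) → ∀ u, φ (ω₁ h₁ u) = ω₂ h₂ (φ u)) →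
      ∀ (V : Type uV) [AddCommGroup V] [Module ℂ V] [TopologicalSpace V]
        (π : Representation ℂ G V), Periods.TotDisc.IsIrrAdmissibleSmooth π →
        Cardinal.lift.{uW₂} (Module.rank ℂ (Periods.periods (ι₁ : H₁ →* G) π ω₁)) =
          Cardinal.lift.{uW₁} (Module.rank ℂ (Periods.periods (ι₂ : H₂ →* G)
            (Periods.TotDisc.contragredient π) ω₂))) := by
  refine ⟨?_, ?_⟩
  · intro E _ _ _ G _ _ _ _ _ H₁ _ _ _ H₂ _ _ _ ι₁ ι₂ _ _ W₁ _ _ _ W₂ _ _ _ ω₁ ω₂ _ _ σ φ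
      hσ hH hφ V _ _ _ π hπ
    -- The Chevalley property is applied to the given `π` alone; it yields the `A` that the
    -- transport requires.
    obtain ⟨A, hA⟩ := hσ V π hπ
    exact Periods.lift_rank_periods_eq A φ hH hA hφ
  · intro G _ _ _ _ _ _ _ H₁ _ _ _ H₂ _ _ _ ι₁ ι₂ _ _ W₁ _ _ _ W₂ _ _ _ ω₁ ω₂ _ _ σ φ
      hσ hH hφ V _ _ _ π hπ
    obtain ⟨A, hA⟩ := hσ V π hπ
    exact Periods.lift_rank_periods_eq A φ hH hA hφ
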